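/- Let $(\Omega,\mathcal F)$ be a measurable space carrying real random variables $X_1,X_2,\dots$, let $\mathcal F_n=\sigma(X_1,\dots,X_n)$, and let $\mathcal P$ be a set of probability measures on $(\Omega,\mathcal F)$. Fix $\theta\in\mathbb R$, $\delta>0$ and $\gamma\in(0,1/2)$. Suppose that under every $P\in\mathcal P$ the sequence $(X_n)$ is iid with mean $\mathbb E_P[X_1]=\theta$ and $\mathbb E_P|X_1-\theta|^{2+\delta}<\infty$, and that $\sup_{P\in\mathcal P}\mathbb E_P|X_1|^{2+\delta}<\infty$. Let $(T_n)$ be a sequence of nonnegative numbers with $$T_n=o\!\left(\frac{n^{\delta\gamma/2}}{(\log n)^{2+\delta/2}}\right)\qquad(n\to\infty),$$ and let $F$ be any probability measure on $\mathbb R$. Put $S_k(\theta)=\sum_{i=1}^k(X_i-\theta)$, $\overline X_k=\frac1k\sum_{i=1}^kX_i$, $\hat s_k^2=\frac1k\sum_{i=1}^k(X_i-\overline X_k)^2$, and for $k\ge m\ge 2$ $$E_k^{(m)}(\theta)=\left(\int_{\mathbb R}\exp\left\{\lambda S_k(\theta)-k\left(\hat s_k^2+\frac1{\log m}\right)\frac{\lambda^2}2\right\}dF(\lambda)\right)\wedge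 T_m .$$ Then the array $\big(E_k^{(m)}(\theta)\big)_{k\ge m\ge2}$ is a $\mathcal P$-uniform asymptotic e-process: its entries are nonnegative random variables, and for every stopping time $\tau$ of the filtration $(\mathcal F_n)$, $$\limsup_{m\to\infty}\ \sup_{P\in\mathcal P}\ \mathbb E_P\left[E^{(m)}_{\tau\vee m}(\theta)\right]\le 1 .$$ Here $\tau$ may take the value $\infty$, with $E^{(m)}_\infty(\theta):=\limsup_{k\to\infty}E^{(m)}_k(\theta)$, and the supremum over an empty $\mathcal P$ is $0$. -/

import Mathlib

open MeasureTheory ProbabilityTheory Filter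
open scoped ENNReal Topology Asymptotics

namespace AsympEProcess

noncomputable section

/-- The class of probability distributions on `ℝ` with mean `θ` and finite `q`-th moment. -/
def momentClass (q θ : ℝ) : Set (Measure ℝ) :=
  {Q | IsProbabilityMeasure Q ∧ Integrable (fun x : ℝ => x) Q ∧ ∫ x, x ∂Q = θ ∧
    Integrable (fun x : ℝ => |x - θ| ^ q) Q}

/-- `Y` has a `Pcal`-uniformly bounded `q`-th moment: `sup_{P ∈ Pcal} E_P |Y| ^ q < ∞`. -/
def UniformlyBoundedMoment {Ω : Type*} [MeasurableSpace Ω] (Pcal : Set (ProbabilityMeasure Ω))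
    (q : ℝ) (Y : Ω → ℝ) : Prop :=
  (⨆ P ∈ Pcal, ∫⁻ ω, ENNReal.ofReal (|Y ω| ^ q) ∂(P : Measure Ω)) < ∞

/-- `(X i)` is an iid sequence under `P`. -/
def IsIID {Ω : Type*} [MeasurableSpace Ω] (X : ℕ → Ω → ℝ) (P : Measure Ω) : Prop :=
  iIndepFun X P ∧ ∀ i, IdentDistrib (X i) (X 0) P P

/-- The filtration of the observations. The observations are indexed from `0`, so the first `n`
of them are `X 0, …, X (n - 1)`, and the `n`-th sigma-algebra is the one which they generate. -/
def obsFiltration {Ω : Type*} [mΩ : MeasurableSpace Ω] (X : ℕ → Ω → ℝ)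
    (hX : ∀ i, Measurable (X i)) : Filtration ℕ mΩ where
  seq n := ⨆ i, ⨆ (_ : i < n), MeasurableSpace.comap (X i) inferInstance
  mono' _ _ hnk := iSup_mono fun _ => iSup_mono' fun hi => ⟨hi.trans_le hnk, le_rfl⟩
  le' _ := iSup_le fun i => iSup_le fun _ => (hX i).comap_le

/-- The value `Y_σ` of a nonnegative process at a random time `σ` with values in `ℕ ∪ {∞}`, where
`Y_∞` is `limsup_k Y_k`. -/
def valueAt {Ω : Type*} (Y : ℕ → Ω → ℝ≥0∞) (σ : Ω → WithTop ℕ) (ω : Ω) : ℝ≥0∞ :=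
  open Classical in
  if σ ω = ⊤ then limsup (fun k => Y k ω) atTop else Y ((σ ω).untopD 0) ω

/-- `Pcal`-uniform asymptotic e-processes with respect to a filtration `𝓕`: an upper triangular array
`E m k`, `m ≤ k`, of nonnegative random variables such that, for every `𝓕`-stopping time `τ`,
`limsup_m sup_{P ∈ Pcal} E_P [E^{(m)}_{τ ∨ m}] ≤ 1`. -/
def IsAsymptoticEProcess {Ω : Type*} [mΩ : MeasurableSpace Ω] (𝓕 : Filtration ℕ mΩ)
    (Pcal : Set (ProbabilityMeasure Ω)) (E : ℕ → ℕ → Ω → ℝ≥0∞) : Prop :=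
  (∀ m k, m ≤ k → Measurable (E m k)) ∧
  ∀ τ : Ω → WithTop ℕ, IsStoppingTime 𝓕 τ →
    limsup (fun m : ℕ => ⨆ P ∈ Pcal,
      ∫⁻ ω, valueAt (E m) (fun ω' => max (τ ω') (m : WithTop ℕ)) ω ∂(P : Measure Ω)) atTop ≤ 1

/-- The centred sum `S_k(θ)` of the first `k` observations. -/
def centredSum {Ω : Type*} (X : ℕ → Ω → ℝ) (θ : ℝ) (k : ℕ) (ω : Ω) : ℝ :=
  ∑ i ∈ Finset.range k, (X i ω - θ)

/-- The mean of the first `k` observations. -/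
def sampleMean {Ω : Type*} (X : ℕ → Ω → ℝ) (k : ℕ) (ω : Ω) : ℝ :=
  (k : ℝ)⁻¹ * ∑ i ∈ Finset.range k, X i ω

/-- The biased sample variance of the first `k` observations. -/
def sampleVar {Ω : Type*} (X : ℕ → Ω → ℝ) (k : ℕ) (ω : Ω) : ℝ :=
  (k : ℝ)⁻¹ * ∑ i ∈ Finset.range k, (X i ω - sampleMean X k ω) ^ 2

/-- The array
`E^{(m)}_k = (∫ exp (l S_k(θ) - k (ŝ_k² + 1 / log m) l² / 2) dF(l)) ∧ T_m`. -/
def mixtureArray {Ω : Type*} (X : ℕ → Ω → ℝ) (θ : ℝ) (F : Measure ℝ) (T : ℕ → ℝ)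
    (m k : ℕ) (ω : Ω) : ℝ≥0∞ :=
  min (∫⁻ l : ℝ, ENNReal.ofReal (Real.exp (l * centredSum X θ k ω
      - k * (sampleVar X k ω + (Real.log m)⁻¹) * l ^ 2 / 2)) ∂F)
    (ENNReal.ofReal (T m))

end

end AsympEProcess

/-!
With `Y_i = X_i - θ`, `S_k = ∑ Y_i` and `V_k = ∑ Y_i²`, the elementary inequality
`exp (x - x² / 2) ≤ 1 + x + 12 |x| ^ q`, valid for all real `x` when `2 ≤ q ≤ 3`, shows that
`exp (l S_k - l² V_k / 2 - k D |l| ^ q)` is a nonnegative supermartingale for every `l`, where `D`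
depends on the law only through a bound on its `q`-th moment (`exp_sub_sq_div_two_le`,
`lintegral_exp_compensated_le`, `isNonnegSupermartingale_compensatedExp`). Since the squares
compensate themselves, neither truncation nor a strong approximation is needed.

The exponent of the array involves `k (ŝ_k² + 1 / log m) = V_k - S_k² / k + k / log m`. Suppose that
`|S_k / k| ≤ k ^ (-η)` for all `k ≥ m`. Then for `|l| ≤ 2 m ^ (-η) log m` and large `m` the term
`k / log m` exceeds `S_k² / k` by enough to pay for `k D |l| ^ q`, and the integrand is at most the
supermartingale; for the other `l` the exponent is negative, and the integrand is at most `1`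
(`mixtureArray_le_truncatedMixture`). So the array is dominated from time `m` on by a mixture of
nonnegative supermartingales that starts at `1`. Such a process has expectation at most `1` at every
stopping time, infinite values included, by almost sure convergence and Fatou's lemma
(`IsNonnegSupermartingale.lintegral_valueAt_le`).

On the complementary event the array is at most `T_m`. The same exponential process at
`l = ± k ^ (-(1 - 2 η))`, with Jensen's inequality for the moment of `V_k / k`, gives
`P (|S_k / k| > k ^ (-η)) ≤ C k ^ (-(1 + δ / 4))` uniformly over the class
(`exists_measure_lt_abs_centredSum_le`). Summed over `k ≥ m` this is `o (m ^ (-δ γ / 2))`, because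
`γ < 1 / 2`, so its product with `T_m` tends to `0` (`tendsto_ofReal_mul_tsum_tail`).
-/

namespace AsympEProcess

/-! ### Nonnegative supermartingales at arbitrary stopping times -/

/-- A nonnegative supermartingale with values in `[0, ∞]`. The supermartingale property is stated
for integrals over events of the past, so that neither integrability nor a conditional expectation
is needed. -/
structure IsNonnegSupermartingale {Ω : Type*} [mΩ : MeasurableSpace Ω] (𝓕 : Filtration ℕ mΩ)
    (P : Measure Ω) (Z : ℕ → Ω → ℝ≥0∞) : Prop where
  measurable : ∀ k, Measurable[𝓕 k] (Z k)
  setLIntegral_succ_le : ∀ k s, MeasurableSet[𝓕 k] s →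
    ∫⁻ ω in s, Z (k + 1) ω ∂P ≤ ∫⁻ ω in s, Z k ω ∂P

namespace IsNonnegSupermartingale

variable {Ω : Type*} [mΩ : MeasurableSpace Ω] {𝓕 : Filtration ℕ mΩ} {P : Measure Ω}
  {Z : ℕ → Ω → ℝ≥0∞}

lemma lintegral_le (hZ : IsNonnegSupermartingale 𝓕 P Z) (k : ℕ) :
    ∫⁻ ω, Z k ω ∂P ≤ ∫⁻ ω, Z 0 ω ∂P := by
  induction k with
  | zero => rfl
  | succ k ih =>
    have h := hZ.setLIntegral_succ_le k Set.univ MeasurableSet.univ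
    simp only [setLIntegral_univ] at h
    exact h.trans ih

lemma ae_exists_tendsto [IsFiniteMeasure P] (hZ : IsNonnegSupermartingale 𝓕 P Z)
    (h0 : ∫⁻ ω, Z 0 ω ∂P ≠ ∞) : ∀ᵐ ω ∂P, ∃ c, Tendsto (fun k => Z k ω) atTop (𝓝 c) := by
  have hmeas : ∀ k, Measurable (Z k) := fun k => (hZ.measurable k).mono (𝓕.le k) le_rfl
  have hfin : ∀ k, ∫⁻ ω, Z k ω ∂P ≠ ∞ := fun k => ne_top_of_le_ne_top h0 (hZ.lintegral_le k)
  have hae : ∀ k, ∀ᵐ ω ∂P, Z k ω < ∞ := fun k => ae_lt_top (hmeas k) (hfin k)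
  have hint : ∀ k, Integrable (fun ω => (Z k ω).toReal) P := fun k =>
    integrable_toReal_of_lintegral_ne_top (hmeas k).aemeasurable (hfin k)
  have hset : ∀ k s, ∫ ω in s, (Z k ω).toReal ∂P = (∫⁻ ω in s, Z k ω ∂P).toReal := fun k s =>
    integral_toReal (hmeas k).aemeasurable (ae_restrict_of_ae (hae k))
  have hsuper : Supermartingale (fun k ω => (Z k ω).toReal) 𝓕 P := by
    refine supermartingale_of_setIntegral_succ_le
      (fun k => (hZ.measurable k).ennreal_toReal.stronglyMeasurable) hint fun k s hs => ?_
    rw [hset, hset]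
    exact ENNReal.toReal_mono (ne_top_of_le_ne_top (hfin k) (setLIntegral_le_lintegral _ _))
      (hZ.setLIntegral_succ_le k s hs)
  have hbdd : ∀ k, eLpNorm ((-fun k ω => (Z k ω).toReal) k) 1 P
      ≤ ((∫⁻ ω, Z 0 ω ∂P).toNNReal : ℝ≥0∞) := by
    intro k
    rw [ENNReal.coe_toNNReal h0, Pi.neg_apply, eLpNorm_neg, eLpNorm_one_eq_lintegral_enorm]
    refine le_trans (lintegral_mono fun ω => ?_) (hZ.lintegral_le k)
    rw [Real.enorm_of_nonneg ENNReal.toReal_nonneg]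
    exact ENNReal.ofReal_toReal_le
  filter_upwards [hsuper.neg.exists_ae_tendsto_of_bdd hbdd, ae_all_iff.2 hae] with ω ⟨c, hc⟩ hω
  refine ⟨ENNReal.ofReal (-c), (ENNReal.tendsto_ofReal hc.neg).congr fun k => ?_⟩
  simp [ENNReal.ofReal_toReal (hω k).ne]

end IsNonnegSupermartingale

/-- The process `Z` frozen at the random time `τ`, that is `Z_{τ ∧ k}`. The recursion makes
adaptedness and the supermartingale property immediate. -/
noncomputable def frozen {Ω : Type*} (Z : ℕ → Ω → ℝ≥0∞) (τ : Ω → WithTop ℕ) : ℕ → Ω → ℝ≥0∞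
  | 0 => Z 0
  | k + 1 => fun ω => open Classical in
      if τ ω ≤ (k : WithTop ℕ) then frozen Z τ k ω else Z (k + 1) ω

lemma frozen_of_le {Ω : Type*} {Z : ℕ → Ω → ℝ≥0∞} {τ : Ω → WithTop ℕ} {ω : Ω} {k : ℕ}
    (h : (k : WithTop ℕ) ≤ τ ω) : frozen Z τ k ω = Z k ω := by
  cases k with
  | zero => rfl
  | succ k =>
    have : ¬ τ ω ≤ (k : WithTop ℕ) := fun h' =>
      absurd (WithTop.coe_le_coe.1 (h.trans h')) (by simp)
    simp [frozen, this]

lemma frozen_of_ge {Ω : Type*} {Z : ℕ → Ω → ℝ≥0∞} {τ : Ω → WithTop ℕ} {ω : Ω} {n k : ℕ}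
    (h : τ ω = (n : WithTop ℕ)) (hk : n ≤ k) : frozen Z τ k ω = Z n ω := by
  induction k, hk using Nat.le_induction with
  | base => exact frozen_of_le h.ge
  | succ k hk ih =>
    have : τ ω ≤ (k : WithTop ℕ) := h ▸ WithTop.coe_le_coe.2 hk
    simp [frozen, this, ih]

/-- The value at `τ`, with the convention for `τ = ∞`, is the upper limit of the frozen process. -/
lemma limsup_frozen {Ω : Type*} (Z : ℕ → Ω → ℝ≥0∞) (τ : Ω → WithTop ℕ) (ω : Ω) :
    limsup (fun k => frozen Z τ k ω) atTop = valueAt Z τ ω := by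
  classical
  unfold valueAt
  split_ifs with h
  · congr 1
    funext k
    exact frozen_of_le (h ▸ le_top)
  · obtain ⟨n, hn⟩ := WithTop.ne_top_iff_exists.1 h
    rw [← hn, WithTop.untopD_coe]
    refine Tendsto.limsup_eq (tendsto_const_nhds.congr' ?_)
    filter_upwards [eventually_ge_atTop n] with k hk
    exact (frozen_of_ge hn.symm hk).symm

lemma valueAt_mono {Ω : Type*} {Y Z : ℕ → Ω → ℝ≥0∞} {m : ℕ} {τ : Ω → WithTop ℕ} {ω : Ω}
    (hτ : (m : WithTop ℕ) ≤ τ ω) (h : ∀ k, m ≤ k → Y k ω ≤ Z k ω) :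
    valueAt Y τ ω ≤ valueAt Z τ ω := by
  classical
  unfold valueAt
  split_ifs with ht
  · exact limsup_le_limsup ((eventually_ge_atTop m).mono h)
  · obtain ⟨n, hn⟩ := WithTop.ne_top_iff_exists.1 ht
    rw [← hn] at hτ ⊢
    exact h _ (WithTop.coe_le_coe.1 hτ)

lemma valueAt_const {Ω : Type*} (c : ℝ≥0∞) (τ : Ω → WithTop ℕ) (ω : Ω) :
    valueAt (fun _ _ => c) τ ω = c := by
  simp [valueAt]

namespace IsNonnegSupermartingale

variable {Ω : Type*} [mΩ : MeasurableSpace Ω] {𝓕 : Filtration ℕ mΩ} {P : Measure Ω}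
  {Z : ℕ → Ω → ℝ≥0∞}

lemma frozen (hZ : IsNonnegSupermartingale 𝓕 P Z) {τ : Ω → WithTop ℕ}
    (hτ : IsStoppingTime 𝓕 τ) : IsNonnegSupermartingale 𝓕 P (frozen Z τ) where
  measurable k := by
    classical
    induction k with
    | zero => exact hZ.measurable 0
    | succ k ih =>
      exact Measurable.ite (𝓕.mono k.le_succ _ (hτ k)) (ih.mono (𝓕.mono k.le_succ) le_rfl)
        (hZ.measurable (k + 1))
  setLIntegral_succ_le k s hs := by
    classical
    have ht : MeasurableSet[𝓕 k] {ω | τ ω ≤ (k : WithTop ℕ)} := hτ k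
    have ht' := 𝓕.le k _ ht
    have hs' := 𝓕.le k _ hs
    rw [← lintegral_inter_add_sdiff _ s ht', ← lintegral_inter_add_sdiff _ s ht']
    refine add_le_add (setLIntegral_mono' (hs'.inter ht') fun ω hω => ?_) ?_
    · have : τ ω ≤ (k : WithTop ℕ) := hω.2
      simp [AsympEProcess.frozen, this]
    · calc ∫⁻ ω in s \ {ω | τ ω ≤ (k : WithTop ℕ)}, AsympEProcess.frozen Z τ (k + 1) ω ∂P
          = ∫⁻ ω in s \ {ω | τ ω ≤ (k : WithTop ℕ)}, Z (k + 1) ω ∂P := by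
            refine setLIntegral_congr_fun (hs'.diff ht') fun ω hω => ?_
            have : ¬ τ ω ≤ (k : WithTop ℕ) := hω.2
            simp [AsympEProcess.frozen, this]
        _ ≤ ∫⁻ ω in s \ {ω | τ ω ≤ (k : WithTop ℕ)}, Z k ω ∂P :=
            hZ.setLIntegral_succ_le k _ (hs.diff ht)
        _ = ∫⁻ ω in s \ {ω | τ ω ≤ (k : WithTop ℕ)}, AsympEProcess.frozen Z τ k ω ∂P := by
            refine setLIntegral_congr_fun (hs'.diff ht') fun ω hω => ?_
            have : ¬ τ ω ≤ (k : WithTop ℕ) := hω.2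
            exact (frozen_of_le (not_le.1 this).le).symm

/-- Optional stopping at an arbitrary stopping time, infinite values included: the frozen process
converges almost surely, so Fatou's lemma controls its upper limit. -/
lemma lintegral_valueAt_le [IsFiniteMeasure P] (hZ : IsNonnegSupermartingale 𝓕 P Z)
    (h0 : ∫⁻ ω, Z 0 ω ∂P ≠ ∞) {τ : Ω → WithTop ℕ} (hτ : IsStoppingTime 𝓕 τ) :
    ∫⁻ ω, valueAt Z τ ω ∂P ≤ ∫⁻ ω, Z 0 ω ∂P := by
  have hW := hZ.frozen hτ
  calc ∫⁻ ω, valueAt Z τ ω ∂P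
      = ∫⁻ ω, liminf (fun k => AsympEProcess.frozen Z τ k ω) atTop ∂P := by
        refine lintegral_congr_ae ?_
        filter_upwards [hW.ae_exists_tendsto h0] with ω ⟨c, hc⟩
        rw [← limsup_frozen, hc.limsup_eq, hc.liminf_eq]
    _ ≤ liminf (fun k => ∫⁻ ω, AsympEProcess.frozen Z τ k ω ∂P) atTop :=
        lintegral_liminf_le fun k => (hW.measurable k).mono (𝓕.le k) le_rfl
    _ ≤ liminf (fun _ : ℕ => ∫⁻ ω, Z 0 ω ∂P) atTop :=
        liminf_le_liminf (Eventually.of_forall hW.lintegral_le)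
    _ = ∫⁻ ω, Z 0 ω ∂P := liminf_const _

/-- A mixture of nonnegative supermartingales is a nonnegative supermartingale. -/
lemma lintegral_mixture [SFinite P] {F : Measure ℝ} [SFinite F] {M : ℝ → ℕ → Ω → ℝ≥0∞}
    (hM : ∀ l, IsNonnegSupermartingale 𝓕 P (M l))
    (hmeas : ∀ k, Measurable[(𝓕 k).prod (inferInstance : MeasurableSpace ℝ)]
      fun x : Ω × ℝ => M x.2 k x.1) :
    IsNonnegSupermartingale 𝓕 P fun k ω => ∫⁻ l, M l k ω ∂F where
  measurable k := @Measurable.lintegral_prod_right' Ω ℝ (𝓕 k) _ F _ _ (hmeas k)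
  setLIntegral_succ_le k s hs := by
    have hm : ∀ k, Measurable fun x : Ω × ℝ => M x.2 k x.1 := fun k =>
      (hmeas k).mono (sup_le_sup (MeasurableSpace.comap_mono (𝓕.le k)) le_rfl) le_rfl
    have hswap : ∀ j, ∫⁻ ω in s, ∫⁻ l, M l j ω ∂F ∂P = ∫⁻ l, ∫⁻ ω in s, M l j ω ∂P ∂F := fun j =>
      lintegral_lintegral_swap (f := fun ω l => M l j ω) (hm j).aemeasurable
    rw [hswap, hswap]
    exact lintegral_mono fun l => (hM l).setLIntegral_succ_le k s hs

end IsNonnegSupermartingale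

/-! ### Self-normalized exponential bounds -/

lemma exp_sub_sq_div_two_le {q : ℝ} (hq2 : 2 ≤ q) (hq3 : q ≤ 3) (x : ℝ) :
    Real.exp (x - x ^ 2 / 2) ≤ 1 + x + 12 * |x| ^ q := by
  rcases le_or_gt |x| (1 / 2) with hx | hx
  · have hx3 : |x| ^ 3 ≤ |x| ^ q := by
      rcases (abs_nonneg x).eq_or_lt with h | h
      · rw [← h, Real.zero_rpow (by linarith)]; norm_num
      · rw [← Real.rpow_natCast]
        exact Real.rpow_le_rpow_of_exponent_ge h (by linarith) (by exact_mod_cast hq3)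
    obtain ⟨h1, h2⟩ := abs_le.1 hx
    set u := x - x ^ 2 / 2 with hu
    have hxx : x ^ 2 = |x| * |x| := by rw [← sq, sq_abs]
    have hua : |u| ≤ 5 / 4 * |x| := by
      calc |u| ≤ |x| + |x ^ 2 / 2| := abs_sub _ _
        _ = |x| + x ^ 2 / 2 := by rw [abs_of_nonneg (by positivity : 0 ≤ x ^ 2 / 2)]
        _ ≤ _ := by nlinarith [abs_nonneg x]
    have he := Real.exp_bound (x := u) (by linarith) (n := 3) (by norm_num)
    have h3 : |u| ^ 3 ≤ 2 * |x| ^ 3 := by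
      calc |u| ^ 3 ≤ (5 / 4 * |x|) ^ 3 := by gcongr
        _ ≤ 2 * |x| ^ 3 := by
          rw [mul_pow]; gcongr; norm_num
    have he' := (abs_le.1 he).2
    norm_num [Finset.sum_range_succ, Nat.factorial] at he'
    have hx4 : x ^ 4 ≤ |x| ^ 3 := by
      have : x ^ 4 = |x| ^ 3 * |x| := by
        rw [← pow_succ, Even.pow_abs ⟨2, rfl⟩]
      rw [this]
      exact mul_le_of_le_one_right (by positivity) (by linarith)
    have hxc : -x ^ 3 ≤ |x| ^ 3 := by
      rw [← abs_pow]; exact neg_le_abs _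
    have hexp : u ^ 2 = x ^ 2 - x ^ 3 + x ^ 4 / 4 := by rw [hu]; ring
    have hu' : u = x - x ^ 2 / 2 := hu
    nlinarith [pow_nonneg (abs_nonneg x) 3]
  · have hle : Real.exp (x - x ^ 2 / 2) ≤ 2 := by
      calc Real.exp (x - x ^ 2 / 2) ≤ Real.exp (1 / 2) := by
            gcongr; nlinarith [sq_nonneg (x - 1)]
        _ ≤ 2 := by
            have h := Real.exp_bound' (x := 1 / 2) (by norm_num) (by norm_num) (n := 3)
              (by norm_num)
            norm_num [Finset.sum_range_succ, Nat.factorial] at h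
            linarith
    have hpow : |x| ≤ 4 * |x| ^ q := by
      have h1 : (1 : ℝ) ≤ 2 * |x| := by linarith
      have h2 : 2 * |x| ≤ (2 * |x|) ^ q := by
        calc 2 * |x| = (2 * |x|) ^ (1 : ℝ) := (Real.rpow_one _).symm
          _ ≤ _ := Real.rpow_le_rpow_of_exponent_le h1 (by linarith)
      rw [Real.mul_rpow (by norm_num) (abs_nonneg x)] at h2
      have h3 : (2 : ℝ) ^ q ≤ 2 ^ (3 : ℝ) := Real.rpow_le_rpow_of_exponent_le (by norm_num) hq3
      have h4 : (2 : ℝ) ^ (3 : ℝ) = 8 := by norm_num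
      nlinarith [Real.rpow_nonneg (abs_nonneg x) q]
    nlinarith [neg_abs_le x]

/-- The exponential moment of a centred variable, compensated by its square: no exponential moment
is needed, and the error is of order `|l| ^ q`. -/
lemma lintegral_exp_compensated_le {Ω : Type*} [MeasurableSpace Ω] {P : Measure Ω}
    [IsProbabilityMeasure P] {Y : Ω → ℝ} {q D : ℝ} (hq2 : 2 ≤ q)
    (hq3 : q ≤ 3) (hint : Integrable Y P) (hmean : ∫ ω, Y ω ∂P = 0)
    (hintq : Integrable (fun ω => |Y ω| ^ q) P) (hD : 12 * ∫ ω, |Y ω| ^ q ∂P ≤ D) (l : ℝ) :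
    ∫⁻ ω, ENNReal.ofReal (Real.exp (l * Y ω - l ^ 2 * Y ω ^ 2 / 2 - D * |l| ^ q)) ∂P ≤ 1 := by
  have hpt : ∀ ω, Real.exp (l * Y ω - l ^ 2 * Y ω ^ 2 / 2 - D * |l| ^ q)
      ≤ (1 + l * Y ω + 12 * |l| ^ q * |Y ω| ^ q) * Real.exp (-(D * |l| ^ q)) := by
    intro ω
    have h := exp_sub_sq_div_two_le hq2 hq3 (l * Y ω)
    rw [abs_mul, Real.mul_rpow (abs_nonneg _) (abs_nonneg _), mul_pow] at h
    rw [sub_eq_add_neg, Real.exp_add]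
    gcongr
    linarith
  have hI : Integrable (fun ω => (1 + l * Y ω + 12 * |l| ^ q * |Y ω| ^ q)
      * Real.exp (-(D * |l| ^ q))) P :=
    (((integrable_const 1).add (hint.const_mul l)).add (hintq.const_mul _)).mul_const _
  calc ∫⁻ ω, ENNReal.ofReal (Real.exp (l * Y ω - l ^ 2 * Y ω ^ 2 / 2 - D * |l| ^ q)) ∂P
      ≤ ∫⁻ ω, ENNReal.ofReal ((1 + l * Y ω + 12 * |l| ^ q * |Y ω| ^ q)
          * Real.exp (-(D * |l| ^ q))) ∂P :=
        lintegral_mono fun ω => ENNReal.ofReal_le_ofReal (hpt ω)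
    _ = ENNReal.ofReal (∫ ω, (1 + l * Y ω + 12 * |l| ^ q * |Y ω| ^ q)
          * Real.exp (-(D * |l| ^ q)) ∂P) :=
        (ofReal_integral_eq_lintegral_ofReal hI
          (Eventually.of_forall fun ω => (Real.exp_pos _).le.trans (hpt ω))).symm
    _ ≤ ENNReal.ofReal 1 := by
        refine ENNReal.ofReal_le_ofReal ?_
        have hcalc : ∫ ω, (1 + l * Y ω + 12 * |l| ^ q * |Y ω| ^ q) ∂P
            = 1 + |l| ^ q * (12 * ∫ ω, |Y ω| ^ q ∂P) := by
          have hA : Integrable (fun ω => 1 + l * Y ω) P :=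
            (integrable_const 1).add (hint.const_mul l)
          rw [integral_add hA (hintq.const_mul _), integral_add (integrable_const 1)
            (hint.const_mul l), integral_const_mul, integral_const_mul, hmean]
          simp
          ring
        rw [integral_mul_const, hcalc, Real.exp_neg, ← div_eq_mul_inv,
          div_le_one (Real.exp_pos _)]
        calc 1 + |l| ^ q * (12 * ∫ ω, |Y ω| ^ q ∂P) ≤ 1 + |l| ^ q * D := by gcongr
          _ ≤ Real.exp (D * |l| ^ q) := by
            have := Real.add_one_le_exp (D * |l| ^ q)
            linarith
    _ = 1 := ENNReal.ofReal_one

/-! ### The compensated exponential process -/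

/-- The sum of squares `V_k` of the first `k` centred observations. -/
noncomputable def centredSqSum {Ω : Type*} (X : ℕ → Ω → ℝ) (θ : ℝ) (k : ℕ) (ω : Ω) : ℝ :=
  ∑ i ∈ Finset.range k, (X i ω - θ) ^ 2

/-- The process `exp (l S_k - l² V_k / 2 - k D |l| ^ q)`, with values in `[0, ∞]`. -/
noncomputable def compensatedExp {Ω : Type*} (X : ℕ → Ω → ℝ) (θ q D l : ℝ) (k : ℕ) (ω : Ω) :
    ℝ≥0∞ :=
  ENNReal.ofReal (Real.exp (l * centredSum X θ k ω - l ^ 2 * centredSqSum X θ k ω / 2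
    - k * (D * |l| ^ q)))

lemma compensatedExp_zero {Ω : Type*} (X : ℕ → Ω → ℝ) (θ q D l : ℝ) (ω : Ω) :
    compensatedExp X θ q D l 0 ω = 1 := by
  simp [compensatedExp, centredSum, centredSqSum]

lemma compensatedExp_succ {Ω : Type*} (X : ℕ → Ω → ℝ) (θ q D l : ℝ) (k : ℕ) (ω : Ω) :
    compensatedExp X θ q D l (k + 1) ω = compensatedExp X θ q D l k ω *
      ENNReal.ofReal (Real.exp (l * (X k ω - θ) - l ^ 2 * (X k ω - θ) ^ 2 / 2 - D * |l| ^ q)) := by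
  rw [compensatedExp, compensatedExp, ← ENNReal.ofReal_mul (Real.exp_pos _).le, ← Real.exp_add]
  congr 2
  simp only [centredSum, centredSqSum, Finset.sum_range_succ]
  push_cast
  ring

section

variable {Ω : Type*} [mΩ : MeasurableSpace Ω] {X : ℕ → Ω → ℝ}

lemma measurable_obsFiltration (hX : ∀ i, Measurable (X i)) {i k : ℕ} (h : i < k) :
    Measurable[obsFiltration X hX k] (X i) :=
  Measurable.of_comap_le (le_iSup₂_of_le (f := fun i (_ : i < k) =>
    MeasurableSpace.comap (X i) inferInstance) i h le_rfl)

lemma measurable_centredSum (hX : ∀ i, Measurable (X i)) (θ : ℝ) (k : ℕ) :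
    Measurable[obsFiltration X hX k] (centredSum X θ k) :=
  Finset.measurable_fun_sum _ fun _ hi =>
    (measurable_obsFiltration hX (Finset.mem_range.1 hi)).sub_const θ

lemma measurable_centredSqSum (hX : ∀ i, Measurable (X i)) (θ : ℝ) (k : ℕ) :
    Measurable[obsFiltration X hX k] (centredSqSum X θ k) :=
  Finset.measurable_fun_sum _ fun _ hi =>
    ((measurable_obsFiltration hX (Finset.mem_range.1 hi)).sub_const θ).pow_const 2

lemma measurable_exp_compensator_prod {Ω : Type*} [MeasurableSpace Ω] {S V : Ω → ℝ}
    (hS : Measurable S) (hV : Measurable V) (c q D : ℝ) :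
    Measurable fun x : Ω × ℝ => ENNReal.ofReal (Real.exp (x.2 * S x.1 - x.2 ^ 2 * V x.1 / 2
      - c * (D * |x.2| ^ q))) := by
  have hS' : Measurable fun x : Ω × ℝ => S x.1 := hS.comp measurable_fst
  have hV' : Measurable fun x : Ω × ℝ => V x.1 := hV.comp measurable_fst
  exact ((((measurable_snd.mul hS').sub (((measurable_snd.pow_const 2).mul hV').div_const 2)).sub
    (((measurable_snd.abs.pow_const q).const_mul D).const_mul _)).exp).ennreal_ofReal

lemma measurable_ite_abs_le_prod {Ω : Type*} [MeasurableSpace Ω] {f : Ω × ℝ → ℝ≥0∞}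
    (hf : Measurable f) (r : ℝ) :
    Measurable fun x : Ω × ℝ => if |x.2| ≤ r then f x else 1 :=
  Measurable.ite (measurableSet_le measurable_snd.abs measurable_const) hf measurable_const

lemma measurable_compensatedExp_prod (hX : ∀ i, Measurable (X i)) (θ q D : ℝ) (k : ℕ) :
    Measurable[(obsFiltration X hX k).prod (inferInstance : MeasurableSpace ℝ)]
      fun x : Ω × ℝ => compensatedExp X θ q D x.2 k x.1 := by
  exact @measurable_exp_compensator_prod Ω (obsFiltration X hX k) _ _
    (measurable_centredSum hX θ k) (measurable_centredSqSum hX θ k) (k : ℝ) q D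

lemma indep_obsFiltration (hX : ∀ i, Measurable (X i)) {P : Measure Ω} (h : iIndepFun X P)
    (k : ℕ) : Indep (obsFiltration X hX k) (MeasurableSpace.comap (X k) inferInstance) P := by
  have h1 := indep_iSup_of_disjoint (fun i => (hX i).comap_le) h.iIndep
    (S := {i | i < k}) (T := {k}) (by simp)
  simpa [obsFiltration] using h1

lemma isNonnegSupermartingale_compensatedExp (hX : ∀ i, Measurable (X i)) {P : Measure Ω}
    [IsProbabilityMeasure P] (hiid : IsIID X P) {θ q D l : ℝ}
    (hone : ∫⁻ ω, ENNReal.ofReal (Real.exp (l * (X 0 ω - θ) - l ^ 2 * (X 0 ω - θ) ^ 2 / 2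
      - D * |l| ^ q)) ∂P ≤ 1) :
    IsNonnegSupermartingale (obsFiltration X hX) P (compensatedExp X θ q D l) where
  measurable k := (measurable_compensatedExp_prod hX θ q D k).comp
    (@measurable_prodMk_right _ _ (obsFiltration X hX k) _ l)
  setLIntegral_succ_le k s hs := by
    have hM : Measurable[obsFiltration X hX k] (compensatedExp X θ q D l k) :=
      (measurable_compensatedExp_prod hX θ q D k).comp
        (@measurable_prodMk_right _ _ (obsFiltration X hX k) _ l)
    have hg : Measurable fun x : ℝ => ENNReal.ofReal (Real.exp (l * (x - θ)
        - l ^ 2 * (x - θ) ^ 2 / 2 - D * |l| ^ q)) := by fun_prop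
    have hs' := (obsFiltration X hX).le k s hs
    have hone' : ∫⁻ ω, ENNReal.ofReal (Real.exp (l * (X k ω - θ) - l ^ 2 * (X k ω - θ) ^ 2 / 2
        - D * |l| ^ q)) ∂P ≤ 1 := by
      refine le_of_eq_of_le ?_ hone
      exact ((hiid.2 k).comp hg).lintegral_eq
    rw [← lintegral_indicator hs', ← lintegral_indicator hs']
    calc ∫⁻ ω, s.indicator (compensatedExp X θ q D l (k + 1)) ω ∂P
        = ∫⁻ ω, s.indicator (compensatedExp X θ q D l k) ω *
            ENNReal.ofReal (Real.exp (l * (X k ω - θ) - l ^ 2 * (X k ω - θ) ^ 2 / 2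
              - D * |l| ^ q)) ∂P := by
          refine lintegral_congr fun ω => ?_
          by_cases hω : ω ∈ s
          · simp [hω, compensatedExp_succ]
          · simp [hω]
      _ = (∫⁻ ω, s.indicator (compensatedExp X θ q D l k) ω ∂P) *
            ∫⁻ ω, ENNReal.ofReal (Real.exp (l * (X k ω - θ) - l ^ 2 * (X k ω - θ) ^ 2 / 2
              - D * |l| ^ q)) ∂P :=
          lintegral_mul_eq_lintegral_mul_lintegral_of_independent_measurableSpace
            ((obsFiltration X hX).le k) (hX k).comap_le (indep_obsFiltration hX hiid.1 k)
            (hM.indicator hs) (hg.comp (comap_measurable (X k)))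
      _ ≤ ∫⁻ ω, s.indicator (compensatedExp X θ q D l k) ω ∂P := mul_le_of_le_one_right' hone'

/-- The mixture over `l` of the compensated exponential processes, with the parameters `|l| > r`
replaced by the constant process `1`. -/
noncomputable def truncatedMixture (X : ℕ → Ω → ℝ) (θ q D r : ℝ) (F : Measure ℝ) (k : ℕ) (ω : Ω) :
    ℝ≥0∞ :=
  ∫⁻ l, (if |l| ≤ r then compensatedExp X θ q D l k ω else 1) ∂F

lemma truncatedMixture_zero {Ω : Type*} (X : ℕ → Ω → ℝ) (θ q D r : ℝ) (F : Measure ℝ) [IsProbabilityMeasure F]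
    (ω : Ω) : truncatedMixture X θ q D r F 0 ω = 1 := by
  simp [truncatedMixture, compensatedExp_zero]

lemma isNonnegSupermartingale_truncatedMixture (hX : ∀ i, Measurable (X i)) {P : Measure Ω}
    [IsProbabilityMeasure P] (hiid : IsIID X P) {θ q D : ℝ}
    (hone : ∀ l : ℝ, ∫⁻ ω, ENNReal.ofReal (Real.exp (l * (X 0 ω - θ) - l ^ 2 * (X 0 ω - θ) ^ 2 / 2
      - D * |l| ^ q)) ∂P ≤ 1) (r : ℝ) (F : Measure ℝ) [IsProbabilityMeasure F] :
    IsNonnegSupermartingale (obsFiltration X hX) P (truncatedMixture X θ q D r F) := by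
  refine IsNonnegSupermartingale.lintegral_mixture
    (M := fun l k ω => if |l| ≤ r then compensatedExp X θ q D l k ω else 1) (fun l => ?_)
    fun k => ?_
  · by_cases hl : |l| ≤ r
    · simpa [hl] using isNonnegSupermartingale_compensatedExp hX hiid (hone l)
    · simp only [hl, if_false]
      exact ⟨fun _ => measurable_const, fun _ _ _ => le_rfl⟩
  · exact @measurable_ite_abs_le_prod Ω (obsFiltration X hX k) _
      (measurable_compensatedExp_prod hX θ q D k) r

end

/-! ### Deviations of the sample mean -/

/-- Jensen's inequality for the mean of the squares. -/
lemma rpow_centredSqSum_div_le {Ω : Type*} (X : ℕ → Ω → ℝ) (θ : ℝ) {p : ℝ} (hp : 2 ≤ p) {k : ℕ}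
    (hk : k ≠ 0) (ω : Ω) :
    (centredSqSum X θ k ω / k) ^ (p / 2) ≤ ∑ i ∈ Finset.range k, (k : ℝ)⁻¹ * |X i ω - θ| ^ p := by
  have hk' : (k : ℝ) ≠ 0 := Nat.cast_ne_zero.2 hk
  have h := Real.rpow_arith_mean_le_arith_mean_rpow (Finset.range k) (fun _ => (k : ℝ)⁻¹)
    (fun i => (X i ω - θ) ^ 2) (fun _ _ => by positivity) (by simp [hk'])
    (fun _ _ => sq_nonneg _) (p := p / 2) (by linarith)
  rw [← Finset.mul_sum, inv_mul_eq_div] at h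
  refine h.trans_eq (Finset.sum_congr rfl fun i _ => ?_)
  rw [← sq_abs, ← Real.rpow_natCast, ← Real.rpow_mul (abs_nonneg _)]
  congr 2
  push_cast
  ring

section

variable {Ω : Type*} [mΩ : MeasurableSpace Ω] {X : ℕ → Ω → ℝ}

lemma measure_le_centredSqSum (hX : ∀ i, Measurable (X i)) {P : Measure Ω}
    (hiid : IsIID X P) {θ p : ℝ} (hp : 2 ≤ p) {K : ℝ≥0∞}
    (hK : ∫⁻ ω, ENNReal.ofReal (|X 0 ω - θ| ^ p) ∂P ≤ K) {k : ℕ} (hk : k ≠ 0) {a : ℝ}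
    (ha : 0 < a) :
    P {ω | k * a ≤ centredSqSum X θ k ω} ≤ ENNReal.ofReal (a ^ (-(p / 2))) * K := by
  have hk' : (0 : ℝ) < k := Nat.cast_pos.2 (Nat.pos_of_ne_zero hk)
  have hg : Measurable fun x : ℝ => ENNReal.ofReal (|x - θ| ^ p) :=
    (((measurable_id.sub_const θ).abs).pow_const p).ennreal_ofReal
  have hVm : Measurable (centredSqSum X θ k) :=
    (measurable_centredSqSum hX θ k).mono ((obsFiltration X hX).le k) le_rfl
  have hint : ∫⁻ ω, ENNReal.ofReal ((centredSqSum X θ k ω / k) ^ (p / 2)) ∂P ≤ K := by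
    calc ∫⁻ ω, ENNReal.ofReal ((centredSqSum X θ k ω / k) ^ (p / 2)) ∂P
        ≤ ∫⁻ ω, ∑ i ∈ Finset.range k,
            ENNReal.ofReal (k : ℝ)⁻¹ * ENNReal.ofReal (|X i ω - θ| ^ p) ∂P := by
          refine lintegral_mono fun ω => ?_
          refine (ENNReal.ofReal_le_ofReal (rpow_centredSqSum_div_le X θ hp hk ω)).trans_eq ?_
          rw [ENNReal.ofReal_sum_of_nonneg fun _ _ => by positivity]
          exact Finset.sum_congr rfl fun i _ => ENNReal.ofReal_mul (by positivity)
      _ = ∑ i ∈ Finset.range k,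
            ENNReal.ofReal (k : ℝ)⁻¹ * ∫⁻ ω, ENNReal.ofReal (|X i ω - θ| ^ p) ∂P := by
          have hgX : ∀ i, Measurable fun ω => ENNReal.ofReal (|X i ω - θ| ^ p) := fun i =>
            hg.comp (hX i)
          rw [lintegral_finsetSum _ fun i _ => (hgX i).const_mul _]
          exact Finset.sum_congr rfl fun i _ => lintegral_const_mul _ (hgX i)
      _ ≤ ∑ i ∈ Finset.range k, ENNReal.ofReal (k : ℝ)⁻¹ * K := by
          gcongr with i _
          exact le_of_eq_of_le ((hiid.2 i).comp hg).lintegral_eq hK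
      _ = K := by
          rw [Finset.sum_const, Finset.card_range, nsmul_eq_mul, ← mul_assoc,
            ← ENNReal.ofReal_natCast, ← ENNReal.ofReal_mul hk'.le, mul_inv_cancel₀ hk'.ne',
            ENNReal.ofReal_one, one_mul]
  have hpow : 0 < a ^ (p / 2) := Real.rpow_pos_of_pos ha _
  calc P {ω | k * a ≤ centredSqSum X θ k ω}
      ≤ P {ω | ENNReal.ofReal (a ^ (p / 2)) ≤
          ENNReal.ofReal ((centredSqSum X θ k ω / k) ^ (p / 2))} := by
        refine measure_mono fun ω hω => ENNReal.ofReal_le_ofReal ?_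
        refine Real.rpow_le_rpow ha.le ?_ (by linarith)
        rw [le_div_iff₀ hk', mul_comm]
        exact hω
    _ ≤ (∫⁻ ω, ENNReal.ofReal ((centredSqSum X θ k ω / k) ^ (p / 2)) ∂P) /
          ENNReal.ofReal (a ^ (p / 2)) :=
        meas_ge_le_lintegral_div (((hVm.div_const _).pow_const _).ennreal_ofReal).aemeasurable
          (ENNReal.ofReal_pos.2 hpow).ne' ENNReal.ofReal_ne_top
    _ ≤ K / ENNReal.ofReal (a ^ (p / 2)) := by gcongr
    _ = ENNReal.ofReal (a ^ (-(p / 2))) * K := by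
        rw [Real.rpow_neg ha.le, ENNReal.ofReal_inv_of_pos hpow, div_eq_mul_inv, mul_comm]

lemma measure_le_compensated (hX : ∀ i, Measurable (X i)) {P : Measure Ω}
    [IsProbabilityMeasure P] (hiid : IsIID X P) {θ q D l : ℝ}
    (hone : ∫⁻ ω, ENNReal.ofReal (Real.exp (l * (X 0 ω - θ) - l ^ 2 * (X 0 ω - θ) ^ 2 / 2
      - D * |l| ^ q)) ∂P ≤ 1) (k : ℕ) (x : ℝ) :
    P {ω | x ≤ l * centredSum X θ k ω - l ^ 2 * centredSqSum X θ k ω / 2 - k * (D * |l| ^ q)}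
      ≤ ENNReal.ofReal (Real.exp (-x)) := by
  have hM := isNonnegSupermartingale_compensatedExp hX hiid hone
  have hint : ∫⁻ ω, compensatedExp X θ q D l k ω ∂P ≤ 1 := by
    simpa [compensatedExp_zero] using hM.lintegral_le k
  calc P {ω | x ≤ l * centredSum X θ k ω - l ^ 2 * centredSqSum X θ k ω / 2 - k * (D * |l| ^ q)}
      ≤ P {ω | ENNReal.ofReal (Real.exp x) ≤ compensatedExp X θ q D l k ω} :=
        measure_mono fun ω hω => ENNReal.ofReal_le_ofReal (Real.exp_le_exp.2 hω)
    _ ≤ (∫⁻ ω, compensatedExp X θ q D l k ω ∂P) / ENNReal.ofReal (Real.exp x) :=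
        meas_ge_le_lintegral_div
          ((hM.measurable k).mono ((obsFiltration X hX).le k) le_rfl).aemeasurable
          (ENNReal.ofReal_pos.2 (Real.exp_pos x)).ne' ENNReal.ofReal_ne_top
    _ ≤ 1 / ENNReal.ofReal (Real.exp x) := by gcongr
    _ = ENNReal.ofReal (Real.exp (-x)) := by
        rw [Real.exp_neg, ENNReal.ofReal_inv_of_pos (Real.exp_pos x), one_div]

/-- If `|S_k| > k ^ (1 - η)`, then either the mean of the squares is large or one of the
compensated exponentials with parameter `± k ^ (-(1 - 2 η))` is large. -/
lemma measure_lt_abs_centredSum (hX : ∀ i, Measurable (X i)) {P : Measure Ω}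
    [IsProbabilityMeasure P] (hiid : IsIID X P) {θ p q D : ℝ} (hp : 2 ≤ p) {K : ℝ≥0∞}
    (hK : ∫⁻ ω, ENNReal.ofReal (|X 0 ω - θ| ^ p) ∂P ≤ K)
    (hone : ∀ l : ℝ, ∫⁻ ω, ENNReal.ofReal (Real.exp (l * (X 0 ω - θ) - l ^ 2 * (X 0 ω - θ) ^ 2 / 2
      - D * |l| ^ q)) ∂P ≤ 1) {η : ℝ} {k : ℕ} (hk : k ≠ 0)
    (hDk : D * (k : ℝ) ^ (1 - (1 - 2 * η) * q) ≤ (k : ℝ) ^ η / 3) :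
    P {ω | (k : ℝ) ^ (1 - η) < |centredSum X θ k ω|} ≤
      2 * ENNReal.ofReal (Real.exp (-((k : ℝ) ^ η / 3))) +
      ENNReal.ofReal ((2 / 3 * (k : ℝ) ^ (1 - 3 * η)) ^ (-(p / 2))) * K := by
  have hk' : (0 : ℝ) < k := Nat.cast_pos.2 (Nat.pos_of_ne_zero hk)
  set l : ℝ := (k : ℝ) ^ (-(1 - 2 * η)) with hl
  have hlpos : 0 < l := Real.rpow_pos_of_pos hk' _
  have hlq : k * (D * |l| ^ q) ≤ (k : ℝ) ^ η / 3 := by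
    refine le_of_eq_of_le ?_ hDk
    rw [abs_of_pos hlpos, hl, ← Real.rpow_mul hk'.le,
      show 1 - (1 - 2 * η) * q = 1 + -(1 - 2 * η) * q by ring, Real.rpow_add hk', Real.rpow_one]
    ring
  have hl2 : l ^ 2 * (k * (2 / 3 * (k : ℝ) ^ (1 - 3 * η))) = 2 / 3 * (k : ℝ) ^ η := by
    have : (k : ℝ) ^ η = l * l * (k * (k : ℝ) ^ (1 - 3 * η)) := by
      conv_rhs => enter [2, 1]; rw [← Real.rpow_one (k : ℝ)]
      rw [hl, ← Real.rpow_add hk', ← Real.rpow_add hk', ← Real.rpow_add hk']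
      congr 1; ring
    rw [this]; ring
  have hl1 : l * (k : ℝ) ^ (1 - η) = (k : ℝ) ^ η := by
    rw [hl, ← Real.rpow_add hk']; congr 1; ring
  set A : ℝ → Set Ω := fun l => {ω | (k : ℝ) ^ η / 3 ≤
    l * centredSum X θ k ω - l ^ 2 * centredSqSum X θ k ω / 2 - k * (D * |l| ^ q)} with hA
  set V : Set Ω := {ω | k * (2 / 3 * (k : ℝ) ^ (1 - 3 * η)) ≤ centredSqSum X θ k ω} with hV
  have hsub : {ω | (k : ℝ) ^ (1 - η) < |centredSum X θ k ω|} ⊆ (A l ∪ A (-l)) ∪ V := by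
    intro ω hω
    by_contra hcon
    simp only [hA, hV, Set.mem_union, Set.mem_ofPred_eq, not_or, not_le, abs_neg, neg_sq] at hcon
    obtain ⟨⟨h1, h2⟩, h3⟩ := hcon
    have h4 : l ^ 2 * centredSqSum X θ k ω < 2 / 3 * (k : ℝ) ^ η := by
      rw [← hl2]; gcongr
    have h5 : (k : ℝ) ^ η < l * |centredSum X θ k ω| := by
      rw [← hl1]; exact mul_lt_mul_of_pos_left hω hlpos
    rcases abs_cases (centredSum X θ k ω) with ⟨h, -⟩ | ⟨h, -⟩ <;> rw [h] at h5 <;> nlinarith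
  calc P {ω | (k : ℝ) ^ (1 - η) < |centredSum X θ k ω|}
      ≤ P (A l ∪ A (-l)) + P V := (measure_mono hsub).trans (measure_union_le _ _)
    _ ≤ (P (A l) + P (A (-l))) + P V := by gcongr; exact measure_union_le _ _
    _ ≤ _ := by
      rw [two_mul]
      gcongr
      · exact measure_le_compensated hX hiid (hone l) k _
      · exact measure_le_compensated hX hiid (hone (-l)) k _
      · exact measure_le_centredSqSum hX hiid hp hK hk (by positivity)

/-- The polynomial rate for the deviations of the sample mean, with constants that depend on the
law only through the moment bounds. -/
lemma exists_measure_lt_abs_centredSum_le (hX : ∀ i, Measurable (X i)) {δ : ℝ} (hδ : 0 < δ)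
    {q : ℝ} (hq : 2 ≤ q) (D : ℝ) {K : ℝ≥0∞} (hKtop : K ≠ ∞) (θ : ℝ) :
    ∃ η : ℝ, 0 < η ∧ ∃ C : ℝ, 0 ≤ C ∧ ∀ᶠ k : ℕ in atTop, ∀ P : Measure Ω,
      IsProbabilityMeasure P → IsIID X P →
      ∫⁻ ω, ENNReal.ofReal (|X 0 ω - θ| ^ (2 + δ)) ∂P ≤ K →
      (∀ l : ℝ, ∫⁻ ω, ENNReal.ofReal (Real.exp (l * (X 0 ω - θ) - l ^ 2 * (X 0 ω - θ) ^ 2 / 2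
        - D * |l| ^ q)) ∂P ≤ 1) →
      P {ω | (k : ℝ) ^ (1 - η) < |centredSum X θ k ω|} ≤
        ENNReal.ofReal (C * (k : ℝ) ^ (-(1 + δ / 4))) := by
  -- The exponent is chosen so that `(1 - 3 η) (2 + δ) / 2 = 1 + δ / 4`.
  set η : ℝ := (1 - (1 + δ / 4) / (1 + δ / 2)) / 3 with hη
  have hη3 : 1 - 3 * η = (1 + δ / 4) / (1 + δ / 2) := by rw [hη]; ring
  have hηexp : (1 - 3 * η) * ((2 + δ) / 2) = 1 + δ / 4 := by
    rw [hη3]; field_simp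
  have hlt : (1 + δ / 4) / (1 + δ / 2) < 1 := by rw [div_lt_one (by linarith)]; linarith
  have hgt : 1 / 2 < (1 + δ / 4) / (1 + δ / 2) := by
    rw [lt_div_iff₀ (by linarith)]; linarith
  have hη0 : 0 < η := by rw [hη]; linarith
  have hcast : Tendsto (fun k : ℕ => (k : ℝ)) atTop atTop := tendsto_natCast_atTop_atTop
  have hpow : Tendsto (fun k : ℕ => (k : ℝ) ^ η) atTop atTop :=
    (tendsto_rpow_atTop hη0).comp hcast
  have hev1 : ∀ᶠ k : ℕ in atTop, D * (k : ℝ) ^ (1 - (1 - 2 * η) * q) ≤ (k : ℝ) ^ η / 3 := by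
    filter_upwards [hpow.eventually_ge_atTop (3 * |D|), eventually_ge_atTop 1] with k hk hk1
    have hk1' : (1 : ℝ) ≤ k := by exact_mod_cast hk1
    have : (k : ℝ) ^ (1 - (1 - 2 * η) * q) ≤ 1 :=
      Real.rpow_le_one_of_one_le_of_nonpos hk1' (by nlinarith)
    calc D * (k : ℝ) ^ (1 - (1 - 2 * η) * q) ≤ |D| * 1 := by
          gcongr; exact le_abs_self D
      _ ≤ _ := by linarith
  have hev2 : ∀ᶠ k : ℕ in atTop,
      Real.exp (-((k : ℝ) ^ η / 3)) ≤ (k : ℝ) ^ (-(1 + δ / 4)) := by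
    have h := ((isLittleO_exp_neg_mul_rpow_atTop (a := 1 / 3) (by norm_num)
      (-(1 + δ / 4) / η)).comp_tendsto hpow).bound one_pos
    filter_upwards [h] with k hk
    simp only [Function.comp_apply, Real.norm_eq_abs, Real.abs_exp, one_mul,
      ← Real.rpow_mul (Nat.cast_nonneg k)] at hk
    rw [mul_div_cancel₀ _ hη0.ne', abs_of_nonneg (by positivity)] at hk
    convert hk using 2
    ring
  refine ⟨η, hη0, 2 + (2 / 3) ^ (-((2 + δ) / 2)) * K.toReal, by positivity, ?_⟩
  filter_upwards [hev1, hev2, eventually_ge_atTop 1] with k h1 h2 hk1 P hP hiid hK hone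
  have hk0 : k ≠ 0 := by omega
  refine (measure_lt_abs_centredSum hX hiid (by linarith) hK hone hk0 h1).trans ?_
  rw [Real.mul_rpow (by norm_num) (by positivity), ← Real.rpow_mul (Nat.cast_nonneg k),
    mul_neg, hηexp, add_mul, ENNReal.ofReal_add (by positivity) (by positivity)]
  gcongr
  · rw [ENNReal.ofReal_mul (by norm_num), ENNReal.ofReal_ofNat]
    gcongr
  · rw [mul_right_comm, ENNReal.ofReal_mul (by positivity) (q := K.toReal),
      ENNReal.ofReal_toReal hKtop, ENNReal.ofReal_mul (by positivity)]

end

/-! ### Domination of the array -/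

lemma natCast_mul_sampleVar {Ω : Type*} (X : ℕ → Ω → ℝ) (θ : ℝ) {k : ℕ} (hk : k ≠ 0) (ω : Ω) :
    k * sampleVar X k ω = centredSqSum X θ k ω - centredSum X θ k ω ^ 2 / k := by
  have hk' : (k : ℝ) ≠ 0 := Nat.cast_ne_zero.2 hk
  have hmean : sampleMean X k ω = θ + centredSum X θ k ω / k := by
    simp only [sampleMean, centredSum, Finset.sum_sub_distrib, Finset.sum_const,
      Finset.card_range, nsmul_eq_mul]
    field_simp
    ring
  have hterm : ∀ i, (X i ω - sampleMean X k ω) ^ 2 = (X i ω - θ) ^ 2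
      - 2 * (centredSum X θ k ω / k) * (X i ω - θ) + (centredSum X θ k ω / k) ^ 2 := by
    intro i; rw [hmean]; ring
  rw [sampleVar, mul_inv_cancel_left₀ hk', Finset.sum_congr rfl fun i _ => hterm i,
    Finset.sum_add_distrib, Finset.sum_sub_distrib, ← Finset.mul_sum]
  change centredSqSum X θ k ω - 2 * (centredSum X θ k ω / k) * centredSum X θ k ω + _ = _
  simp only [Finset.sum_const, Finset.card_range, nsmul_eq_mul]
  field_simp
  ring

lemma sampleVar_nonneg {Ω : Type*} (X : ℕ → Ω → ℝ) (k : ℕ) (ω : Ω) : 0 ≤ sampleVar X k ω :=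
  mul_nonneg (by positivity) (Finset.sum_nonneg fun _ _ => sq_nonneg _)

/-- When the sample mean is within `t` of `θ`, the extra variance `1 / log m` pays for the
compensator and for the centring of the sample variance when `|l| ≤ 2 t log m`, and makes the
exponent negative for the other `l`. -/
lemma mixtureArray_le_truncatedMixture {Ω : Type*} (X : ℕ → Ω → ℝ) {θ q D t : ℝ} (F : Measure ℝ)
    (T : ℕ → ℝ) {m k : ℕ} (hk : k ≠ 0) (hq : 2 < q) (hD : 0 ≤ D) (hL : 0 < Real.log m)
    (ht2 : t ^ 2 ≤ 1 / (2 * Real.log m))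
    (htD : D * (2 * Real.log m * t) ^ (q - 2) ≤ 1 / (4 * Real.log m)) {ω : Ω}
    (hS : |centredSum X θ k ω| ≤ k * t) :
    mixtureArray X θ F T m k ω ≤ truncatedMixture X θ q D (2 * Real.log m * t) F k ω := by
  refine (min_le_left _ _).trans (lintegral_mono fun l => ?_)
  have hk' : (0 : ℝ) < k := Nat.cast_pos.2 (Nat.pos_of_ne_zero hk)
  have hvar := natCast_mul_sampleVar X θ hk ω
  set S := centredSum X θ k ω
  set V := centredSqSum X θ k ω
  set L := Real.log m
  dsimp only
  split_ifs with hl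
  · refine ENNReal.ofReal_le_ofReal (Real.exp_le_exp.2 ?_)
    have hlq : D * |l| ^ q ≤ l ^ 2 / (4 * L) := by
      rcases eq_or_ne l 0 with rfl | hl0
      · simp [Real.zero_rpow (by linarith : q ≠ 0)]
      · have hpos : 0 < |l| := abs_pos.2 hl0
        have h1 : |l| ^ q = |l| ^ (q - 2) * l ^ 2 := by
          rw [← sq_abs l, ← Real.rpow_natCast, ← Real.rpow_add hpos]
          congr 1; push_cast; ring
        have h2 : |l| ^ (q - 2) ≤ (2 * L * t) ^ (q - 2) :=
          Real.rpow_le_rpow hpos.le hl (by linarith)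
        calc D * |l| ^ q = D * |l| ^ (q - 2) * l ^ 2 := by rw [h1]; ring
          _ ≤ D * (2 * L * t) ^ (q - 2) * l ^ 2 := by gcongr
          _ ≤ 1 / (4 * L) * l ^ 2 := by gcongr
          _ = _ := by ring
    have hS2 : S ^ 2 / k ≤ k / (2 * L) := by
      rw [div_le_iff₀ hk']
      calc S ^ 2 = |S| ^ 2 := (sq_abs S).symm
        _ ≤ (k * t) ^ 2 := by gcongr
        _ = k ^ 2 * t ^ 2 := by ring
        _ ≤ k ^ 2 * (1 / (2 * L)) := by gcongr
        _ = _ := by ring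
    have h3 : k * (sampleVar X k ω + L⁻¹) = V - S ^ 2 / k + k / L := by
      rw [mul_add, hvar]; ring
    rw [h3]
    have h4 : (k : ℝ) * (D * |l| ^ q) ≤ k * (l ^ 2 / (4 * L)) := by gcongr
    have h5 : S ^ 2 / k * l ^ 2 ≤ k / (2 * L) * l ^ 2 := by gcongr
    have h6 : (k : ℝ) * (l ^ 2 / (4 * L)) = k / L * l ^ 2 / 4 := by field_simp
    have h7 : k / (2 * L) * l ^ 2 = k / L * l ^ 2 / 2 := by field_simp
    nlinarith
  · rw [← ENNReal.ofReal_one]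
    refine ENNReal.ofReal_le_ofReal (Real.exp_le_one_iff.2 ?_)
    rw [not_le] at hl
    have h1 : l * S ≤ |l| * (k * t) := by
      calc l * S ≤ |l * S| := le_abs_self _
        _ = |l| * |S| := abs_mul _ _
        _ ≤ _ := by gcongr
    have h2 : 2 * t ≤ |l| * L⁻¹ := by
      rw [← div_eq_mul_inv, le_div_iff₀ hL]; linarith
    have h3 : |l| * k * (2 * t) ≤ |l| * k * (|l| * L⁻¹) := by gcongr
    have h4 : |l| * k * (|l| * L⁻¹) = k * L⁻¹ * l ^ 2 := by rw [← sq_abs l]; ring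
    have h5 : 0 ≤ k * sampleVar X k ω * l ^ 2 :=
      mul_nonneg (mul_nonneg hk'.le (sampleVar_nonneg X k ω)) (sq_nonneg l)
    nlinarith

lemma measurable_mixtureArray {Ω : Type*} [MeasurableSpace Ω] {X : ℕ → Ω → ℝ}
    (hX : ∀ i, Measurable (X i)) (θ : ℝ) (F : Measure ℝ) [SFinite F] (T : ℕ → ℝ) (m k : ℕ) :
    Measurable (mixtureArray X θ F T m k) := by
  have hS : Measurable (centredSum X θ k) :=
    (measurable_centredSum hX θ k).mono ((obsFiltration X hX).le k) le_rfl
  have hmean : Measurable (sampleMean X k) :=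
    (Finset.measurable_fun_sum _ fun i _ => hX i).const_mul _
  have hvar : Measurable (sampleVar X k) :=
    (Finset.measurable_fun_sum _ fun i _ => ((hX i).sub hmean).pow_const 2).const_mul _
  refine Measurable.min (Measurable.lintegral_prod_right' (f := fun x : Ω × ℝ =>
    ENNReal.ofReal (Real.exp (x.2 * centredSum X θ k x.1
      - k * (sampleVar X k x.1 + (Real.log m)⁻¹) * x.2 ^ 2 / 2))) ?_) measurable_const
  have hS' : Measurable fun x : Ω × ℝ => centredSum X θ k x.1 := hS.comp measurable_fst
  have hvar' : Measurable fun x : Ω × ℝ => sampleVar X k x.1 := hvar.comp measurable_fst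
  exact (((measurable_snd.mul hS').sub ((((hvar'.add_const _).const_mul _).mul
    (measurable_snd.pow_const 2)).div_const 2)).exp).ennreal_ofReal

/-! ### Asymptotics of the thresholds -/

lemma tendsto_log_mul_rpow_neg {a η : ℝ} (hη : 0 < η) :
    Tendsto (fun m : ℕ => Real.log m ^ a * (m : ℝ) ^ (-η)) atTop (𝓝 0) := by
  have h := (isLittleO_log_rpow_rpow_atTop a hη).tendsto_div_nhds_zero.comp
    tendsto_natCast_atTop_atTop
  refine h.congr fun m => ?_
  simp [Function.comp_apply, Real.rpow_neg (Nat.cast_nonneg m), div_eq_mul_inv]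

lemma eventually_threshold {q η : ℝ} (D : ℝ) (hq : 2 < q) (hη : 0 < η) :
    ∀ᶠ m : ℕ in atTop, 0 < Real.log m ∧ ((m : ℝ) ^ (-η)) ^ 2 ≤ 1 / (2 * Real.log m) ∧
      D * (2 * Real.log m * (m : ℝ) ^ (-η)) ^ (q - 2) ≤ 1 / (4 * Real.log m) := by
  have hlog : ∀ᶠ m : ℕ in atTop, 0 < Real.log m :=
    (Real.tendsto_log_atTop.comp tendsto_natCast_atTop_atTop).eventually_gt_atTop 0
  have h1 := (tendsto_log_mul_rpow_neg (a := 1) (by linarith : 0 < η * 2)).eventually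
    (gt_mem_nhds (by norm_num : (0 : ℝ) < 1 / 2))
  have h2 := ((tendsto_log_mul_rpow_neg (a := q - 2 + 1)
    (mul_pos hη (by linarith : 0 < q - 2))).const_mul (4 * D * 2 ^ (q - 2))).eventually
    (gt_mem_nhds (by norm_num : 4 * D * 2 ^ (q - 2) * 0 < 1))
  filter_upwards [hlog, h1, h2] with m hL h1 h2
  refine ⟨hL, ?_, ?_⟩
  · rw [← Real.rpow_natCast, ← Real.rpow_mul (Nat.cast_nonneg m), le_div_iff₀ (by positivity)]
    rw [Real.rpow_one] at h1
    push_cast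
    rw [neg_mul]
    linarith
  · rw [Real.mul_rpow (by positivity) (by positivity), Real.mul_rpow (by norm_num) hL.le,
      ← Real.rpow_mul (Nat.cast_nonneg m), le_div_iff₀ (by positivity), neg_mul]
    rw [Real.rpow_add hL, Real.rpow_one] at h2
    nlinarith

lemma tendsto_ofReal_mul_tsum_tail {δ γ : ℝ} (hδ : 0 < δ) (hγ : γ ∈ Set.Ioo (0 : ℝ) (1 / 2))
    {T : ℕ → ℝ} (hT0 : ∀ n, 0 ≤ T n)
    (hT : T =o[atTop] fun n : ℕ => (n : ℝ) ^ (δ * γ / 2) / Real.log n ^ (2 + δ / 2))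
    {C : ℝ} (hC : 0 ≤ C) :
    Tendsto (fun m : ℕ => ENNReal.ofReal (T m) *
      ∑' j : ℕ, ENNReal.ofReal (C * ((m + j : ℕ) : ℝ) ^ (-(1 + δ / 4)))) atTop (𝓝 0) := by
  set β := δ * γ / 2 with hβ
  have hβ0 : 0 < β := by have := mul_pos hδ hγ.1; linarith
  have hβδ : 0 < δ / 4 - β := by nlinarith [hγ.2]
  have hTβ : Tendsto (fun m : ℕ => T m * (m : ℝ) ^ (-β)) atTop (𝓝 0) := by
    have hO : (fun n : ℕ => (n : ℝ) ^ β / Real.log n ^ (2 + δ / 2)) =O[atTop]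
        fun n : ℕ => (n : ℝ) ^ β := by
      refine Asymptotics.IsBigO.of_bound 1 ?_
      filter_upwards [(Real.tendsto_log_atTop.comp
        tendsto_natCast_atTop_atTop).eventually_ge_atTop 1] with n hn
      have h1 : 1 ≤ Real.log n ^ (2 + δ / 2) := Real.one_le_rpow hn (by linarith)
      rw [Real.norm_of_nonneg (by positivity), Real.norm_of_nonneg (by positivity), one_mul]
      exact div_le_self (by positivity) h1
    refine (hT.trans_isBigO hO).tendsto_div_nhds_zero.congr fun m => ?_
    rw [Real.rpow_neg (Nat.cast_nonneg m), div_eq_mul_inv]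
  set G := ∑' j : ℕ, ENNReal.ofReal (C * ((j + 1 : ℕ) : ℝ) ^ (-(1 + (δ / 4 - β)))) with hG
  have hGtop : G ≠ ∞ := by
    refine Summable.tsum_ofReal_ne_top (Summable.mul_left C ?_)
    exact (summable_nat_add_iff 1 (f := fun j : ℕ => (j : ℝ) ^ (-(1 + (δ / 4 - β))))).2
      (Real.summable_nat_rpow.2 (by linarith))
  have hlim : Tendsto (fun m : ℕ => ENNReal.ofReal (T m * (m : ℝ) ^ (-β)) * G) atTop (𝓝 0) := by
    have h := ENNReal.Tendsto.mul_const (b := G) (ENNReal.tendsto_ofReal hTβ) (Or.inr hGtop)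
    simpa using h
  refine tendsto_of_tendsto_of_tendsto_of_le_of_le' tendsto_const_nhds hlim
    (Eventually.of_forall fun _ => zero_le) ?_
  filter_upwards [eventually_ge_atTop 1] with m hm
  have hm' : (0 : ℝ) < m := by exact_mod_cast hm
  rw [ENNReal.ofReal_mul (hT0 m), mul_assoc]
  gcongr
  rw [← ENNReal.tsum_mul_left]
  refine ENNReal.tsum_le_tsum fun j => ?_
  rw [← ENNReal.ofReal_mul (by positivity)]
  refine ENNReal.ofReal_le_ofReal ?_
  have hpos : (0 : ℝ) < ((m + j : ℕ) : ℝ) := by exact_mod_cast (by omega : 0 < m + j)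
  rw [show -(1 + δ / 4) = -β + -(1 + (δ / 4 - β)) by ring, Real.rpow_add hpos,
    mul_left_comm ((m : ℝ) ^ (-β))]
  gcongr ?_ * (?_ * ?_)
  · exact Real.rpow_le_rpow_of_nonpos hm' (by exact_mod_cast Nat.le_add_right m j) (by linarith)
  · exact Real.rpow_le_rpow_of_nonpos (by positivity) (by exact_mod_cast (by omega))
      (by linarith)

/-! ### Uniform moments and the conclusion -/

variable {Ω : Type*} [mΩ : MeasurableSpace Ω]

/-- Centring preserves a uniform bound on the moments. -/
lemma UniformlyBoundedMoment.exists_bound {Pcal : Set (ProbabilityMeasure Ω)} {p : ℝ} (hp : 0 ≤ p)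
    {Y : Ω → ℝ} (h : UniformlyBoundedMoment Pcal p Y) (hY : Measurable Y) (θ : ℝ) :
    ∃ K : ℝ≥0∞, K ≠ ∞ ∧ ∀ P ∈ Pcal,
      ∫⁻ ω, ENNReal.ofReal (|Y ω - θ| ^ p) ∂(P : Measure Ω) ≤ K := by
  set K₀ := ⨆ P ∈ Pcal, ∫⁻ ω, ENNReal.ofReal (|Y ω| ^ p) ∂(P : Measure Ω) with hK₀
  have hK₀top : K₀ ≠ ∞ := h.ne
  refine ⟨ENNReal.ofReal (2 ^ p) * (K₀ + ENNReal.ofReal (|θ| ^ p)), by finiteness,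
    fun P hP => ?_⟩
  have hpt : ∀ x : ℝ, |x - θ| ^ p ≤ 2 ^ p * (|x| ^ p + |θ| ^ p) := by
    intro x
    have h0 : |x - θ| ≤ 2 * max |x| |θ| := by
      have := abs_sub x θ
      linarith [le_max_left |x| |θ|, le_max_right |x| |θ|]
    calc |x - θ| ^ p ≤ (2 * max |x| |θ|) ^ p := by gcongr
      _ = 2 ^ p * (max |x| |θ|) ^ p := Real.mul_rpow (by norm_num) (by positivity)
      _ ≤ _ := by
        gcongr
        rcases max_choice |x| |θ| with h | h <;> rw [h]
        · exact le_add_of_nonneg_right (by positivity)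
        · exact le_add_of_nonneg_left (by positivity)
  have hYp : Measurable fun ω => ENNReal.ofReal (|Y ω| ^ p) := (hY.abs.pow_const p).ennreal_ofReal
  calc ∫⁻ ω, ENNReal.ofReal (|Y ω - θ| ^ p) ∂(P : Measure Ω)
      ≤ ∫⁻ ω, ENNReal.ofReal (2 ^ p) * (ENNReal.ofReal (|Y ω| ^ p) + ENNReal.ofReal (|θ| ^ p))
          ∂(P : Measure Ω) := by
        refine lintegral_mono fun ω => ?_
        rw [← ENNReal.ofReal_add (by positivity) (by positivity),
          ← ENNReal.ofReal_mul (by positivity)]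
        exact ENNReal.ofReal_le_ofReal (hpt _)
    _ = ENNReal.ofReal (2 ^ p) * (∫⁻ ω, ENNReal.ofReal (|Y ω| ^ p) ∂(P : Measure Ω)
          + ENNReal.ofReal (|θ| ^ p)) := by
        rw [lintegral_const_mul _ (hYp.add_const _), lintegral_add_left hYp]
        simp
    _ ≤ _ := by
        gcongr
        exact le_iSup₂ (f := fun (P : ProbabilityMeasure Ω) (_ : P ∈ Pcal) =>
          ∫⁻ ω, ENNReal.ofReal (|Y ω| ^ p) ∂(P : Measure Ω)) P hP

lemma lintegral_exp_compensated_le_of_bound {P : Measure Ω} [IsProbabilityMeasure P] {Y : Ω → ℝ}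
    (hY : Measurable Y) {θ p q : ℝ} (hlaw : P.map Y ∈ momentClass p θ) (hq2 : 2 ≤ q) (hq3 : q ≤ 3)
    (hqp : q ≤ p) {K : ℝ≥0∞} (hKtop : K ≠ ∞)
    (hK : ∫⁻ ω, ENNReal.ofReal (|Y ω - θ| ^ p) ∂P ≤ K) (l : ℝ) :
    ∫⁻ ω, ENNReal.ofReal (Real.exp (l * (Y ω - θ) - l ^ 2 * (Y ω - θ) ^ 2 / 2
      - 12 * (1 + K).toReal * |l| ^ q)) ∂P ≤ 1 := by
  obtain ⟨-, hint, hmean, -⟩ := hlaw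
  have hintY : Integrable Y P :=
    (integrable_map_measure aestronglyMeasurable_id hY.aemeasurable).1 hint
  rw [integral_map (f := fun x : ℝ => x) hY.aemeasurable aestronglyMeasurable_id] at hmean
  have hle : ∫⁻ ω, ENNReal.ofReal (|Y ω - θ| ^ q) ∂P ≤ 1 + K := by
    calc ∫⁻ ω, ENNReal.ofReal (|Y ω - θ| ^ q) ∂P
        ≤ ∫⁻ ω, (1 + ENNReal.ofReal (|Y ω - θ| ^ p)) ∂P := by
          refine lintegral_mono fun ω => ?_
          rw [← ENNReal.ofReal_one, ← ENNReal.ofReal_add zero_le_one (by positivity)]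
          refine ENNReal.ofReal_le_ofReal ?_
          rcases le_total |Y ω - θ| 1 with h | h
          · have := Real.rpow_le_one (abs_nonneg (Y ω - θ)) h (by linarith : 0 ≤ q)
            have := Real.rpow_nonneg (abs_nonneg (Y ω - θ)) p
            linarith
          · have := Real.rpow_le_rpow_of_exponent_le h hqp
            linarith
      _ ≤ 1 + K := by
          rw [lintegral_add_left measurable_const]
          simpa using hK
  have htop : 1 + K ≠ ∞ := by finiteness
  have hmeas : Measurable fun ω => |Y ω - θ| ^ q := ((hY.sub_const θ).abs).pow_const q
  have hintq : Integrable (fun ω => |Y ω - θ| ^ q) P :=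
    (lintegral_ofReal_ne_top_iff_integrable hmeas.aestronglyMeasurable
      (Eventually.of_forall fun ω => by positivity)).1 (ne_top_of_le_ne_top htop hle)
  refine lintegral_exp_compensated_le (Y := fun ω => Y ω - θ) hq2 hq3
    (hintY.sub (integrable_const θ)) ?_ hintq ?_ l
  · rw [integral_sub hintY (integrable_const θ), hmean]
    simp
  · rw [integral_eq_lintegral_of_nonneg_ae (Eventually.of_forall fun ω => by positivity)
      hmeas.aestronglyMeasurable]
    gcongr

/-- The bound for a single law and a single `m`: the supermartingale accounts for the term `1`,
the event that some later sample mean is far from `θ` for the error. -/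
lemma lintegral_valueAt_mixtureArray_le {X : ℕ → Ω → ℝ} (hX : ∀ i, Measurable (X i))
    {P : Measure Ω} [IsProbabilityMeasure P] (hiid : IsIID X P) {θ q D η : ℝ}
    (hq : 2 < q) (hD : 0 ≤ D) (hη : 0 < η)
    (hone : ∀ l : ℝ, ∫⁻ ω, ENNReal.ofReal (Real.exp (l * (X 0 ω - θ) - l ^ 2 * (X 0 ω - θ) ^ 2 / 2
      - D * |l| ^ q)) ∂P ≤ 1) (T : ℕ → ℝ) (F : Measure ℝ) [IsProbabilityMeasure F] {m : ℕ}
    (hm : m ≠ 0) (hL : 0 < Real.log m) (ht2 : ((m : ℝ) ^ (-η)) ^ 2 ≤ 1 / (2 * Real.log m))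
    (htD : D * (2 * Real.log m * (m : ℝ) ^ (-η)) ^ (q - 2) ≤ 1 / (4 * Real.log m))
    {σ : Ω → WithTop ℕ} (hσ : IsStoppingTime (obsFiltration X hX) σ)
    (hmσ : ∀ ω, (m : WithTop ℕ) ≤ σ ω) :
    ∫⁻ ω, valueAt (mixtureArray X θ F T m) σ ω ∂P ≤ 1 + ENNReal.ofReal (T m) *
      ∑' j : ℕ, P {ω | ((m + j : ℕ) : ℝ) ^ (1 - η) < |centredSum X θ (m + j) ω|} := by
  set B : Set Ω := ⋃ j : ℕ, {ω | ((m + j : ℕ) : ℝ) ^ (1 - η) < |centredSum X θ (m + j) ω|} with hB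
  have hBmeas : MeasurableSet B := MeasurableSet.iUnion fun j =>
    measurableSet_lt measurable_const
      ((measurable_centredSum hX θ _).mono ((obsFiltration X hX).le _) le_rfl).abs
  set Z := truncatedMixture X θ q D (2 * Real.log m * (m : ℝ) ^ (-η)) F with hZ
  have hZsuper : IsNonnegSupermartingale (obsFiltration X hX) P Z :=
    isNonnegSupermartingale_truncatedMixture hX hiid hone _ F
  have hZ0 : ∫⁻ ω, Z 0 ω ∂P = 1 := by simp [hZ, truncatedMixture_zero]
  have hpt : ∀ ω, valueAt (mixtureArray X θ F T m) σ ω ≤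
      valueAt Z σ ω + B.indicator (fun _ => ENNReal.ofReal (T m)) ω := by
    intro ω
    by_cases hω : ω ∈ B
    · rw [Set.indicator_of_mem hω]
      refine le_add_left ?_
      rw [← valueAt_const (ENNReal.ofReal (T m)) σ ω]
      exact valueAt_mono (hmσ ω) fun k _ => min_le_right _ _
    · refine le_add_right (valueAt_mono (hmσ ω) fun k hk => ?_)
      refine mixtureArray_le_truncatedMixture X F T (by omega) hq hD hL ht2 htD ?_
      simp only [hB, Set.mem_iUnion, Set.mem_ofPred_eq, not_exists, not_lt] at hω
      have h := hω (k - m)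
      rw [Nat.add_sub_cancel' hk] at h
      have hk0 : (0 : ℝ) < k := by exact_mod_cast (by omega : 0 < k)
      refine h.trans ?_
      rw [sub_eq_add_neg, Real.rpow_add hk0, Real.rpow_one]
      refine mul_le_mul_of_nonneg_left ?_ hk0.le
      exact Real.rpow_le_rpow_of_nonpos (Nat.cast_pos.2 (Nat.pos_of_ne_zero hm))
        (Nat.cast_le.2 hk) (by linarith)
  calc ∫⁻ ω, valueAt (mixtureArray X θ F T m) σ ω ∂P
      ≤ ∫⁻ ω, (valueAt Z σ ω + B.indicator (fun _ => ENNReal.ofReal (T m)) ω) ∂P :=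
        lintegral_mono hpt
    _ = ∫⁻ ω, valueAt Z σ ω ∂P + ENNReal.ofReal (T m) * P B := by
        rw [lintegral_add_right _ (measurable_const.indicator hBmeas),
          lintegral_indicator_const hBmeas]
    _ ≤ _ := by
        gcongr
        · exact (hZsuper.lintegral_valueAt_le (by simp [hZ0]) hσ).trans_eq hZ0
        · exact measure_iUnion_le _

end AsympEProcess

theorem proposition4 {Ω : Type*} [MeasurableSpace Ω]
    (X : ℕ → Ω → ℝ) (hX : ∀ i, Measurable (X i))
    (Pcal : Set (ProbabilityMeasure Ω)) (θ δ γ : ℝ)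
    (hδ : 0 < δ) (hγ : γ ∈ Set.Ioo (0 : ℝ) (1 / 2))
    (hiid : ∀ P ∈ Pcal, AsympEProcess.IsIID X (P : Measure Ω))
    (hlaw : ∀ P ∈ Pcal, (P : Measure Ω).map (X 0) ∈ AsympEProcess.momentClass (2 + δ) θ)
    (hmom : AsympEProcess.UniformlyBoundedMoment Pcal (2 + δ) (X 0))
    (T : ℕ → ℝ) (hT0 : ∀ n, 0 ≤ T n)
    (hT : T =o[atTop] fun n : ℕ => (n : ℝ) ^ (δ * γ / 2) / Real.log n ^ (2 + δ / 2))
    (F : Measure ℝ) [IsProbabilityMeasure F] :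
    AsympEProcess.IsAsymptoticEProcess (AsympEProcess.obsFiltration X hX) Pcal
      (AsympEProcess.mixtureArray X θ F T) := by
  refine ⟨fun m k _ => AsympEProcess.measurable_mixtureArray hX θ F T m k, fun τ hτ => ?_⟩
  obtain ⟨K, hKtop, hK⟩ := hmom.exists_bound (by linarith) (hX 0) θ
  -- The expansion of the exponential gives nothing beyond the third moment.
  set q : ℝ := min (2 + δ) 3 with hq
  have hq2 : 2 < q := lt_min (by linarith) (by norm_num)
  set D : ℝ := 12 * (1 + K).toReal with hD
  have hD0 : 0 ≤ D := by positivity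
  have hone := fun P (hP : P ∈ Pcal) =>
    AsympEProcess.lintegral_exp_compensated_le_of_bound (hX 0) (hlaw P hP) hq2.le (min_le_right _ _)
      (min_le_left _ _) hKtop (hK P hP)
  obtain ⟨η, hη, C, hC, hdev⟩ :=
    AsympEProcess.exists_measure_lt_abs_centredSum_le hX hδ hq2.le D hKtop θ
  obtain ⟨k₀, hk₀⟩ := eventually_atTop.1 hdev
  have hlim := (AsympEProcess.tendsto_ofReal_mul_tsum_tail hδ hγ hT0 hT hC).const_add 1
  rw [add_zero] at hlim
  refine le_trans (limsup_le_limsup ?_) hlim.limsup_eq.le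
  filter_upwards [AsympEProcess.eventually_threshold D hq2 hη, eventually_ge_atTop k₀,
    eventually_ge_atTop 1] with m ⟨hL, ht2, htD⟩ hmk hm1
  refine iSup₂_le fun P hP => ?_
  refine (AsympEProcess.lintegral_valueAt_mixtureArray_le hX (hiid P hP) hq2 hD0 hη (hone P hP) T F
    (by omega) hL ht2 htD (hτ.max (isStoppingTime_const _ m)) fun ω => le_max_right _ _).trans ?_
  gcongr with j
  exact hk₀ (m + j) (by omega) P inferInstance (hiid P hP) (hK P hP) (hone P hP)
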